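/- Let $n\in\mathbb{N}$, $\mu\in\mathbb{R}^n$, let $\Sigma\in\mathbb{R}^{n\times n}$ be symmetric positive definite, and let $\delta>0$ and $\varepsilon\in(0,1/2)$. Equip $\mathbb{R}^n$ with the ellipsoidal norm $\|v\|:=\|\Sigma^{-1/2}v\|_2$, and let $\|x\|_*:=\sup\{x^\top y:\|y\|\le 1\}$ $(=\|\Sigma^{1/2}x\|_2)$ be its dual norm. For probability distributions $\mathbb{P}_1,\mathbb{P}_2$ on $\mathbb{R}^n$ let $$d_W(\mathbb{P}_1,\mathbb{P}_2):=\inf_{\pi}\mathbb{E}_{(X_1,X_2)\sim\pi}\big[\|X_1-X_2\|\big]\in[0,\infty],$$ where the infimum is over all couplings $\pi$ of $\mathbb{P}_1$ and $\mathbb{P}_2$; on $\mathbb{R}$ define $d_W$ in the same way with the absolute value as norm. Let $\mathcal{P}$ be the set of all probability distributions $\mathbb{Q}$ on $\mathbb{R}^n$ with $d_W(\mathbb{Q},\mathcal{N}(\mu,\Sigma))\le\delta$, and let $\mathcal{P}_0$ be the set of all probability distributions $\mathbb{Q}$ on $\mathbb{R}$ with $d_W(\mathbb{Q},\mathcal{N}(0,1))\le\delta$.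 Define $$\mathcal{Z}:=\Big\{(x,\ell,u)\in\mathbb{R}^n\times\mathbb{R}\times\mathbb{R}:\ \inf_{\mathbb{Q}\in\mathcal{P}}\mathbb{Q}\big[\ell\le x^\top\tilde\xi\le u\big]\ge 1-\varepsilon\Big\},$$ $$\mathcal{Z}_0:=\Big\{(\ell,u)\in\mathbb{R}^2:\ \inf_{\mathbb{Q}\in\mathcal{P}_0}\mathbb{Q}\big[\ell\le\tilde\xi\le u\big]\ge 1-\varepsilon\Big\},$$ where $\tilde\xi$ denotes a random element with distribution $\mathbb{Q}$. Then, for every $x\in\mathbb{R}^n$ with $x\ne 0$ and all $\ell,u\in\mathbb{R}$, $$(x,\ell,u)\in\mathcal{Z}\iff\left(\frac{\ell-x^\top\mu}{\|x\|_*},\ \frac{u-x^\top\mu}{\|x\|_*}\right)\in\mathcal{Z}_0 .$$ -/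

import Mathlib

open MeasureTheory ProbabilityTheory
open scoped ENNReal MatrixOrder

noncomputable section

namespace TwoSidedDRC

/-- `π` is a coupling of `P₁` and `P₂`: a measure on the product with marginals `P₁` and `P₂`. -/
def IsCoupling {E : Type*} [MeasurableSpace E] (P₁ P₂ : Measure E) (π : Measure (E × E)) : Prop :=
  π.map Prod.fst = P₁ ∧ π.map Prod.snd = P₂

/-- The (type-1) Wasserstein distance of `P₁` and `P₂` with respect to the norm `N`: the infimum,
over all couplings, of the expected value of `N (X₁ - X₂)`. It takes values in `[0, ∞]`. -/
def wassersteinDist {E : Type*} [MeasurableSpace E] [Sub E] (N : E → ℝ) (P₁ P₂ : Measure E) :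
    ℝ≥0∞ :=
  ⨅ (π : Measure (E × E)) (_ : IsCoupling P₁ P₂ π), ∫⁻ z, ENNReal.ofReal (N (z.1 - z.2)) ∂π

/-- The Wasserstein ball of radius `δ` around `P`: all probability distributions whose Wasserstein
distance (with respect to the norm `N`) to `P` is at most `δ`. -/
def wassersteinBall {E : Type*} [MeasurableSpace E] [Sub E] (N : E → ℝ) (P : Measure E) (δ : ℝ) :
    Set (Measure E) :=
  {Q | IsProbabilityMeasure Q ∧ wassersteinDist N Q P ≤ ENNReal.ofReal δ}

/-- The ellipsoidal norm `‖v‖ = ‖Σ^{-1/2} v‖₂`. -/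
def ellipsoidalNorm {n : ℕ} (S : Matrix (Fin n) (Fin n) ℝ) (v : EuclideanSpace ℝ (Fin n)) : ℝ :=
  ‖Matrix.toEuclideanCLM (𝕜 := ℝ) (CFC.sqrt S)⁻¹ v‖

/-- The dual norm of a norm `N` on `ℝⁿ`: `‖x‖_* = sup {xᵀ y : N y ≤ 1}`. -/
def dualNorm {n : ℕ} (N : EuclideanSpace ℝ (Fin n) → ℝ) (x : EuclideanSpace ℝ (Fin n)) : ℝ :=
  sSup {r : ℝ | ∃ y : EuclideanSpace ℝ (Fin n), N y ≤ 1 ∧ r = inner ℝ x y}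

/-- The set `𝒵` of all `(x, ℓ, u)` that satisfy the two-sided distributionally robust chance
constraint `inf_{Q ∈ 𝒫} Q[ℓ ≤ xᵀ ξ ≤ u] ≥ 1 - ε`, where `𝒫` is the Wasserstein ball of radius `δ`
around the Gaussian distribution `𝒩(μ, Σ)` for the ellipsoidal norm of `Σ`. -/
def feasibleSet {n : ℕ} (μ : EuclideanSpace ℝ (Fin n)) (S : Matrix (Fin n) (Fin n) ℝ)
    (δ ε : ℝ) : Set (EuclideanSpace ℝ (Fin n) × ℝ × ℝ) :=
  {p | ENNReal.ofReal (1 - ε) ≤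
    ⨅ Q ∈ wassersteinBall (ellipsoidalNorm S) (multivariateGaussian μ S) δ,
      Q {ξ | p.2.1 ≤ inner ℝ p.1 ξ ∧ inner ℝ p.1 ξ ≤ p.2.2}}

/-- The set `𝒵₀` of all `(ℓ, u)` such that `inf_{Q ∈ 𝒫₀} Q[ℓ ≤ ξ ≤ u] ≥ 1 - ε`, where `𝒫₀` is the
Wasserstein ball of radius `δ` around the standard Gaussian distribution on `ℝ`, for the absolute
value as norm. -/
def scalarFeasibleSet (δ ε : ℝ) : Set (ℝ × ℝ) :=
  {p | ENNReal.ofReal (1 - ε) ≤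
    ⨅ Q ∈ wassersteinBall (fun t : ℝ => |t|) (gaussianReal 0 1) δ, Q {ξ | p.1 ≤ ξ ∧ ξ ≤ p.2}}

end TwoSidedDRC

end

/-!
The chance constraint only sees the law of the standardised scalar `T ξ = (xᵀ ξ - xᵀ μ) / ‖x‖_*`, so
it suffices that `T` maps the Wasserstein ball around `𝒩(μ, Σ)` *onto* the one around `𝒩(0, 1)`.

Write `A = Σ^{1/2}` and let `e = A x / ‖A x‖`, a unit vector; duality gives `‖x‖_* = ‖A x‖`. For the
ellipsoidal norm `T` is `1`-Lipschitz, and it maps `𝒩(μ, Σ)` to `𝒩(0, 1)`, so it maps the first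
ball into the second (`wassersteinDist_map_le`).

Conversely, given a law `Q` in the second ball, replace the component along `e` of a standard
Gaussian vector `Z` by an independent variable `t` (`replaceComponent`). If `t` is standard Gaussian,
the result is again standard Gaussian (`map_replaceComponent`), hence `μ + A (replaceComponent e t Z)`
has law `𝒩(μ, Σ)`. If `t` has law `Q`, this vector has a law whose image under `T` is `Q`. Two values
of `t` displace the vector by exactly their distance, so every coupling of `Q` and `𝒩(0, 1)` lifts,
at the same cost, to a coupling of the two laws on `ℝⁿ` (`wassersteinDist_map_prod_le`). The lifted
law does not depend on the coupling, so no optimal coupling is needed.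
-/

namespace TwoSidedDRC

/-! ### Wasserstein distances of images -/

section Wasserstein

variable {E F Z : Type*} [MeasurableSpace E] [MeasurableSpace F] [MeasurableSpace Z]

lemma wassersteinDist_map_le [Sub E] [Sub F] {N : E → ℝ} {N' : F → ℝ} {f : E → F}
    (hf : Measurable f) (hN : ∀ a b, N' (f a - f b) ≤ N (a - b))
    (hN' : Measurable fun z : F × F => N' (z.1 - z.2)) (P₁ P₂ : Measure E) :
    wassersteinDist N' (P₁.map f) (P₂.map f) ≤ wassersteinDist N P₁ P₂ := by
  refine le_iInf₂ fun π hπ => ?_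
  have hc : IsCoupling (P₁.map f) (P₂.map f) (π.map (Prod.map f f)) := by
    constructor
    · rw [Measure.map_map measurable_fst (hf.prodMap hf), ← hπ.1, Measure.map_map hf measurable_fst]
      rfl
    · rw [Measure.map_map measurable_snd (hf.prodMap hf), ← hπ.2, Measure.map_map hf measurable_snd]
      rfl
  refine (iInf₂_le _ hc).trans ?_
  rw [lintegral_map hN'.ennreal_ofReal (hf.prodMap hf)]
  exact lintegral_mono fun z => ENNReal.ofReal_le_ofReal (hN _ _)

/-- Attaching the same independent noise `ρ` to two distributions, and mapping the result by a
function that is nonexpansive in its first argument, does not increase their distance: a coupling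
of the two distributions extends to one that uses the same noise on both sides. -/
lemma wassersteinDist_map_prod_le [Sub E] [Sub F] {N : E → ℝ} {N' : F → ℝ} {G : F × Z → E}
    (hG : Measurable G) (hN : ∀ t s z, N (G (t, z) - G (s, z)) ≤ N' (t - s))
    (hNm : Measurable fun z : E × E => N (z.1 - z.2))
    (hNm' : Measurable fun z : F × F => N' (z.1 - z.2))
    (P₁ P₂ : Measure F) [IsFiniteMeasure P₁] (ρ : Measure Z) [IsProbabilityMeasure ρ] :
    wassersteinDist N ((P₁.prod ρ).map G) ((P₂.prod ρ).map G) ≤ wassersteinDist N' P₁ P₂ := by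
  refine le_iInf₂ fun π hπ => ?_
  have hfin : IsFiniteMeasure π := by
    refine ⟨?_⟩
    have h := measure_lt_top P₁ Set.univ
    rwa [← hπ.1, Measure.map_apply measurable_fst MeasurableSet.univ, Set.preimage_univ] at h
  have hG₁ : Measurable fun w : (F × F) × Z => G (w.1.1, w.2) := by fun_prop
  have hG₂ : Measurable fun w : (F × F) × Z => G (w.1.2, w.2) := by fun_prop
  have hc : IsCoupling ((P₁.prod ρ).map G) ((P₂.prod ρ).map G)
      ((π.prod ρ).map fun w => (G (w.1.1, w.2), G (w.1.2, w.2))) := by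
    constructor
    · rw [Measure.map_map measurable_fst (hG₁.prodMk hG₂), ← hπ.1, ← Measure.map_id (μ := ρ),
        Measure.map_prod_map _ _ measurable_fst measurable_id, Measure.map_id,
        Measure.map_map hG (by fun_prop)]
      rfl
    · rw [Measure.map_map measurable_snd (hG₁.prodMk hG₂), ← hπ.2, ← Measure.map_id (μ := ρ),
        Measure.map_prod_map _ _ measurable_snd measurable_id, Measure.map_id,
        Measure.map_map hG (by fun_prop)]
      rfl
  refine (iInf₂_le _ hc).trans ?_
  rw [lintegral_map hNm.ennreal_ofReal (hG₁.prodMk hG₂)]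
  calc ∫⁻ w, ENNReal.ofReal (N (G (w.1.1, w.2) - G (w.1.2, w.2))) ∂(π.prod ρ)
      ≤ ∫⁻ w, ENNReal.ofReal (N' (w.1.1 - w.1.2)) ∂(π.prod ρ) :=
        lintegral_mono fun w => ENNReal.ofReal_le_ofReal (hN _ _ _)
    _ = ∫⁻ z, ENNReal.ofReal (N' (z.1 - z.2)) ∂π := by
        have h := lintegral_map (μ := π.prod ρ) hNm'.ennreal_ofReal measurable_fst
        rw [← h]
        simp

end Wasserstein

/-! ### Standard Gaussian vectors -/

section Gaussian

variable {E : Type*} [NormedAddCommGroup E] [InnerProductSpace ℝ E]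

/-- The vector `z` with its component along the unit vector `e` replaced by `t`. -/
def replaceComponent (e : E) (t : ℝ) (z : E) : E :=
  z - inner ℝ e z • e + t • e

lemma inner_replaceComponent {e : E} (he : ‖e‖ = 1) (t : ℝ) (z : E) :
    inner ℝ e (replaceComponent e t z) = t := by
  simp [replaceComponent, inner_add_right, inner_sub_right, inner_smul_right, he]

lemma replaceComponent_sub (e : E) (t s : ℝ) (z : E) :
    replaceComponent e t z - replaceComponent e s z = (t - s) • e := by
  simp only [replaceComponent]
  module

variable [FiniteDimensional ℝ E] [MeasurableSpace E] [BorelSpace E]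

lemma measurable_replaceComponent (e : E) :
    Measurable fun w : ℝ × E => replaceComponent e w.1 w.2 := by
  unfold replaceComponent
  fun_prop

lemma map_inner_stdGaussian {e : E} (he : ‖e‖ = 1) :
    (stdGaussian E).map (fun z => inner ℝ e z) = gaussianReal 0 1 := by
  have h := IsGaussian.map_eq_gaussianReal (μ := stdGaussian E) (innerSL ℝ e)
  rw [integral_strongDual_stdGaussian, variance_dual_stdGaussian, innerSL_apply_norm, he] at h
  simpa using h

/-- Replacing one component of a standard Gaussian vector by an independent standard Gaussian
variable yields a standard Gaussian vector. -/
lemma map_replaceComponent {e : E} (he : ‖e‖ = 1) :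
    ((gaussianReal 0 1).prod (stdGaussian E)).map (fun w => replaceComponent e w.1 w.2) =
      stdGaussian E := by
  have hm := measurable_replaceComponent e
  have : IsProbabilityMeasure
      (((gaussianReal 0 1).prod (stdGaussian E)).map fun w => replaceComponent e w.1 w.2) :=
    Measure.isProbabilityMeasure_map hm.aemeasurable
  refine Measure.ext_of_charFun (funext fun y => ?_)
  -- The exponent splits into the pairing of `t` with the component of `y` along `e`, and that of
  -- `z` with the component of `y` orthogonal to `e`.
  have key (w : ℝ × E) : inner ℝ (replaceComponent e w.1 w.2) y =
      inner ℝ w.1 (inner ℝ e y) + inner ℝ w.2 (y - inner ℝ e y • e) := by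
    simp only [replaceComponent, inner_add_left, inner_sub_left, inner_sub_right,
      real_inner_smul_left, real_inner_smul_right, real_inner_comm e w.2]
    simp [mul_comm]
    ring
  have hpyth : ‖y - inner ℝ e y • e‖ ^ 2 = ‖y‖ ^ 2 - (inner ℝ e y) ^ 2 := by
    rw [norm_sub_sq_real, norm_smul, he, real_inner_smul_right, real_inner_comm]
    simp
    ring
  rw [charFun_apply, integral_map hm.aemeasurable (by fun_prop)]
  simp_rw [key, Complex.ofReal_add, add_mul, Complex.exp_add]
  rw [integral_prod_mul (fun t : ℝ => Complex.exp (↑(inner ℝ t (inner ℝ e y)) * Complex.I))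
    (fun z : E => Complex.exp (↑(inner ℝ z (y - inner ℝ e y • e)) * Complex.I)),
    ← charFun_apply, ← charFun_apply, charFun_gaussianReal, charFun_stdGaussian,
    charFun_stdGaussian, ← Complex.exp_add, ← Complex.ofReal_pow ‖y - inner ℝ e y • e‖, hpyth]
  congr 1
  push_cast
  ring

end Gaussian

/-! ### The ellipsoidal norm and its dual -/

section Ellipsoidal

variable {n : ℕ} {S : Matrix (Fin n) (Fin n) ℝ}

/-- The square root `Σ^{1/2}` as an operator on Euclidean space. -/
noncomputable abbrev sqrtCLM (S : Matrix (Fin n) (Fin n) ℝ) :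
    EuclideanSpace ℝ (Fin n) →L[ℝ] EuclideanSpace ℝ (Fin n) :=
  Matrix.toEuclideanCLM (𝕜 := ℝ) (CFC.sqrt S)

lemma isUnit_det_sqrt (hS : S.PosDef) : IsUnit (CFC.sqrt S).det :=
  (Matrix.isUnit_iff_isUnit_det _).1
    (CFC.isUnit_sqrt_iff_isStrictlyPositive.2 hS.isStrictlyPositive)

lemma ellipsoidalNorm_sqrtCLM (hS : S.PosDef) (v : EuclideanSpace ℝ (Fin n)) :
    ellipsoidalNorm S (sqrtCLM S v) = ‖v‖ := by
  rw [ellipsoidalNorm, sqrtCLM, ← mul_apply_eq_comp, ← map_mul,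
    Matrix.nonsing_inv_mul _ (isUnit_det_sqrt hS), map_one, one_apply_eq_self]

lemma sqrtCLM_inv_apply (hS : S.PosDef) (v : EuclideanSpace ℝ (Fin n)) :
    sqrtCLM S (Matrix.toEuclideanCLM (𝕜 := ℝ) (CFC.sqrt S)⁻¹ v) = v := by
  rw [sqrtCLM, ← mul_apply_eq_comp, ← map_mul,
    Matrix.mul_nonsing_inv _ (isUnit_det_sqrt hS), map_one, one_apply_eq_self]

lemma inner_sqrtCLM (x y : EuclideanSpace ℝ (Fin n)) :
    inner ℝ x (sqrtCLM S y) = inner ℝ (sqrtCLM S x) y := by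
  have h : IsSelfAdjoint (sqrtCLM S) := (CFC.sqrt_nonneg S).isSelfAdjoint.map _
  rw [← ContinuousLinearMap.adjoint_inner_left, h.adjoint_eq]

lemma sqrtCLM_ne_zero (hS : S.PosDef) {x : EuclideanSpace ℝ (Fin n)} (hx : x ≠ 0) :
    sqrtCLM S x ≠ 0 := by
  intro h
  have h' := ellipsoidalNorm_sqrtCLM hS x
  rw [h] at h'
  exact hx (norm_eq_zero.1 (by simpa [ellipsoidalNorm] using h'.symm))

/-- The Cauchy-Schwarz inequality for `Σ^{1/2} x` and `Σ^{-1/2} v`. -/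
lemma abs_inner_le_ellipsoidalNorm (hS : S.PosDef) (x v : EuclideanSpace ℝ (Fin n)) :
    |inner ℝ x v| ≤ ‖sqrtCLM S x‖ * ellipsoidalNorm S v := by
  rw [← sqrtCLM_inv_apply hS v, inner_sqrtCLM, ellipsoidalNorm_sqrtCLM hS]
  exact abs_real_inner_le_norm _ _

/-- The supremum is attained at `Σ x / ‖Σ^{1/2} x‖₂`, the case of equality in Cauchy-Schwarz. -/
lemma dualNorm_ellipsoidalNorm (hS : S.PosDef) {x : EuclideanSpace ℝ (Fin n)} (hx : x ≠ 0) :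
    dualNorm (ellipsoidalNorm S) x = ‖sqrtCLM S x‖ := by
  have h0 : ‖sqrtCLM S x‖ ≠ 0 := norm_ne_zero_iff.2 (sqrtCLM_ne_zero hS hx)
  refine IsGreatest.csSup_eq ⟨⟨sqrtCLM S (‖sqrtCLM S x‖⁻¹ • sqrtCLM S x), ?_, ?_⟩, ?_⟩
  · rw [ellipsoidalNorm_sqrtCLM hS, norm_smul, norm_inv, norm_norm, inv_mul_cancel₀ h0]
  · rw [inner_sqrtCLM, real_inner_smul_right, real_inner_self_eq_norm_sq]
    field_simp
  · rintro r ⟨y, hy, rfl⟩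
    calc inner ℝ x y ≤ ‖sqrtCLM S x‖ * ellipsoidalNorm S y :=
          (le_abs_self _).trans (abs_inner_le_ellipsoidalNorm hS x y)
      _ ≤ ‖sqrtCLM S x‖ := mul_le_of_le_one_right (norm_nonneg _) hy

end Ellipsoidal

/-! ### Standardisation -/

section Standardise

variable {n : ℕ} {S : Matrix (Fin n) (Fin n) ℝ} {μ x : EuclideanSpace ℝ (Fin n)}

/-- The scalar `(xᵀ ξ - xᵀ μ) / ‖Σ^{1/2} x‖₂`. -/
noncomputable def standardise (μ : EuclideanSpace ℝ (Fin n)) (S : Matrix (Fin n) (Fin n) ℝ)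
    (x ξ : EuclideanSpace ℝ (Fin n)) : ℝ :=
  (inner ℝ x ξ - inner ℝ x μ) / ‖sqrtCLM S x‖

lemma measurable_standardise : Measurable (standardise μ S x) := by
  unfold standardise
  fun_prop

lemma norm_direction (hS : S.PosDef) (hx : x ≠ 0) :
    ‖‖sqrtCLM S x‖⁻¹ • sqrtCLM S x‖ = 1 := by
  rw [norm_smul, norm_inv, norm_norm,
    inv_mul_cancel₀ (norm_ne_zero_iff.2 (sqrtCLM_ne_zero hS hx))]

lemma standardise_add_sqrtCLM (z : EuclideanSpace ℝ (Fin n)) :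
    standardise μ S x (μ + sqrtCLM S z) = inner ℝ (‖sqrtCLM S x‖⁻¹ • sqrtCLM S x) z := by
  rw [standardise, inner_add_right, inner_sqrtCLM, real_inner_smul_left, add_sub_cancel_left,
    div_eq_inv_mul]

lemma abs_standardise_sub_le (hS : S.PosDef) (hx : x ≠ 0) (a b : EuclideanSpace ℝ (Fin n)) :
    |standardise μ S x a - standardise μ S x b| ≤ ellipsoidalNorm S (a - b) := by
  have h0 : 0 < ‖sqrtCLM S x‖ := norm_pos_iff.2 (sqrtCLM_ne_zero hS hx)
  have h : standardise μ S x a - standardise μ S x b = inner ℝ x (a - b) / ‖sqrtCLM S x‖ := by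
    simp only [standardise, inner_sub_right]
    ring
  rw [h, abs_div, abs_of_pos h0, div_le_iff₀ h0, mul_comm]
  exact abs_inner_le_ellipsoidalNorm hS x _

lemma map_standardise_multivariateGaussian (hS : S.PosDef) (hx : x ≠ 0) :
    (multivariateGaussian μ S).map (standardise μ S x) = gaussianReal 0 1 := by
  rw [multivariateGaussian, Measure.map_map measurable_standardise (by fun_prop),
    ← map_inner_stdGaussian (norm_direction hS hx)]
  exact congrArg (Measure.map · _) (funext standardise_add_sqrtCLM)

/-- The law of `μ + Σ^{1/2} Z`, where `Z` is a standard Gaussian vector whose component along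
`Σ^{1/2} x` has been replaced by an independent variable with law `Q`. -/
noncomputable def liftLaw (μ : EuclideanSpace ℝ (Fin n)) (S : Matrix (Fin n) (Fin n) ℝ)
    (x : EuclideanSpace ℝ (Fin n)) (Q : Measure ℝ) : Measure (EuclideanSpace ℝ (Fin n)) :=
  (Q.prod (stdGaussian (EuclideanSpace ℝ (Fin n)))).map fun w =>
    μ + sqrtCLM S (replaceComponent (‖sqrtCLM S x‖⁻¹ • sqrtCLM S x) w.1 w.2)

lemma measurable_add_sqrtCLM_replaceComponent (e : EuclideanSpace ℝ (Fin n)) :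
    Measurable fun w : ℝ × EuclideanSpace ℝ (Fin n) =>
      μ + sqrtCLM S (replaceComponent e w.1 w.2) :=
  ((sqrtCLM S).measurable.comp (measurable_replaceComponent e)).const_add μ

lemma liftLaw_gaussianReal (hS : S.PosDef) (hx : x ≠ 0) :
    liftLaw μ S x (gaussianReal 0 1) = multivariateGaussian μ S := by
  rw [multivariateGaussian, ← map_replaceComponent (norm_direction hS hx),
    Measure.map_map (by fun_prop) (measurable_replaceComponent _)]
  rfl

lemma map_standardise_liftLaw (hS : S.PosDef) (hx : x ≠ 0) (Q : Measure ℝ)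
    [IsProbabilityMeasure Q] : (liftLaw μ S x Q).map (standardise μ S x) = Q := by
  rw [liftLaw, Measure.map_map measurable_standardise (measurable_add_sqrtCLM_replaceComponent _)]
  have h : (standardise μ S x ∘ fun w : ℝ × EuclideanSpace ℝ (Fin n) =>
      μ + sqrtCLM S (replaceComponent (‖sqrtCLM S x‖⁻¹ • sqrtCLM S x) w.1 w.2)) = Prod.fst := by
    funext w
    rw [Function.comp_apply, standardise_add_sqrtCLM,
      inner_replaceComponent (norm_direction hS hx)]
  rw [h]
  simp

lemma map_standardise_mem_wassersteinBall (hS : S.PosDef) (hx : x ≠ 0) {δ : ℝ}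
    {Q : Measure (EuclideanSpace ℝ (Fin n))}
    (hQ : Q ∈ wassersteinBall (ellipsoidalNorm S) (multivariateGaussian μ S) δ) :
    Q.map (standardise μ S x) ∈ wassersteinBall (fun t : ℝ => |t|) (gaussianReal 0 1) δ := by
  have := hQ.1
  refine ⟨Measure.isProbabilityMeasure_map measurable_standardise.aemeasurable, ?_⟩
  rw [← map_standardise_multivariateGaussian (μ := μ) hS hx]
  exact (wassersteinDist_map_le measurable_standardise (abs_standardise_sub_le hS hx)
    (by fun_prop) _ _).trans hQ.2

lemma liftLaw_mem_wassersteinBall (hS : S.PosDef) (hx : x ≠ 0) {δ : ℝ} {Q : Measure ℝ}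
    (hQ : Q ∈ wassersteinBall (fun t : ℝ => |t|) (gaussianReal 0 1) δ) :
    liftLaw μ S x Q ∈ wassersteinBall (ellipsoidalNorm S) (multivariateGaussian μ S) δ := by
  have := hQ.1
  have hm := measurable_add_sqrtCLM_replaceComponent (μ := μ) (S := S)
    (‖sqrtCLM S x‖⁻¹ • sqrtCLM S x)
  refine ⟨Measure.isProbabilityMeasure_map hm.aemeasurable, ?_⟩
  rw [← liftLaw_gaussianReal hS hx]
  refine (wassersteinDist_map_prod_le hm (fun t s z => ?_) ?_ (by fun_prop) _ _ _).trans hQ.2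
  · rw [add_sub_add_left_eq_sub, ← map_sub, ellipsoidalNorm_sqrtCLM hS, replaceComponent_sub,
      norm_smul, norm_direction hS hx, mul_one, Real.norm_eq_abs]
  · unfold ellipsoidalNorm
    fun_prop

lemma setOf_le_inner_le_eq_preimage (hS : S.PosDef) (hx : x ≠ 0) (l u : ℝ) :
    {ξ | l ≤ inner ℝ x ξ ∧ inner ℝ x ξ ≤ u} = standardise μ S x ⁻¹'
      {t | (l - inner ℝ x μ) / ‖sqrtCLM S x‖ ≤ t ∧ t ≤ (u - inner ℝ x μ) / ‖sqrtCLM S x‖} := by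
  have h0 : 0 < ‖sqrtCLM S x‖ := norm_pos_iff.2 (sqrtCLM_ne_zero hS hx)
  ext ξ
  simp only [Set.mem_ofPred_eq, Set.mem_preimage, standardise, div_le_div_iff_of_pos_right h0,
    sub_le_sub_iff_right]

end Standardise

end TwoSidedDRC

open TwoSidedDRC in
theorem mainTheorem4 (n : ℕ) (μ : EuclideanSpace ℝ (Fin n)) (S : Matrix (Fin n) (Fin n) ℝ)
    (hS : S.PosDef) (δ : ℝ) (hδ : 0 < δ) (ε : ℝ) (hε : ε ∈ Set.Ioo (0 : ℝ) (1 / 2))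
    (x : EuclideanSpace ℝ (Fin n)) (hx : x ≠ 0) (l u : ℝ) :
    (x, l, u) ∈ TwoSidedDRC.feasibleSet μ S δ ε ↔
      ((l - inner ℝ x μ) / TwoSidedDRC.dualNorm (TwoSidedDRC.ellipsoidalNorm S) x,
        (u - inner ℝ x μ) / TwoSidedDRC.dualNorm (TwoSidedDRC.ellipsoidalNorm S) x) ∈
        TwoSidedDRC.scalarFeasibleSet δ ε := by

  rw [dualNorm_ellipsoidalNorm hS hx]
  simp only [feasibleSet, scalarFeasibleSet, Set.mem_ofPred_eq, le_iInf_iff,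
    setOf_le_inner_le_eq_preimage (μ := μ) hS hx]
  have hI (a b : ℝ) : MeasurableSet {t : ℝ | a ≤ t ∧ t ≤ b} := measurableSet_Icc
  constructor
  · intro h Q hQ
    have := hQ.1
    have h' := h _ (liftLaw_mem_wassersteinBall (μ := μ) hS hx hQ)
    rwa [← Measure.map_apply measurable_standardise (hI _ _),
      map_standardise_liftLaw hS hx] at h'
  · intro h Q hQ
    have h' := h _ (map_standardise_mem_wassersteinBall hS hx hQ)
    rwa [Measure.map_apply measurable_standardise (hI _ _)] at h'
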